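/- An operator system is a norm-closed, self-adjoint subspace $\mathcal S\subseteq B(\mathcal H)$ containing $1_{\mathcal S}=1_{\mathcal H}$, where $\mathcal H$ is a nonzero complex Hilbert space. For $E\in B(\mathcal H)$ let $W(E)=\{\langle Ev,v\rangle/\langle v,v\rangle : v\in\mathcal H,\ v\neq 0\}$ be the numerical range and $\|E\|_{\mathrm{diam}}=\sup\{|\lambda-\mu| : \lambda,\mu\in W(E)\}$ the numerical diameter. For a linear map $\Phi:\mathcal S\to\mathcal S'$ between operator systems put \[ \|\Phi\|_{\mathrm{sdiam}}=\sup\Bigl\{\frac{\|\Phi(E)\|_{\mathrm{diam}}}{\|E\|_{\mathrm{diam}}} : E\in\mathcal S,\ E=E^*,\ E\notin\mathbb C\cdot 1_{\mathcal S}\Bigr\}\in[0,\infty] \] (with $\sup\emptyset=0$), and \[ \|\Phi\|_{\mathrm{cbsdiam}}=\sup_{n\ge 1}\|\Phi\otimes \mathrm{id}_n\|_{\mathrm{sdiam}}, \] where $\Phi\otimes\mathrm{id}_n: M_n(\mathcal S)\to M_n(\mathcal S')$ applies $\Phi$ entrywise and $M_n(\mathcal S)=\mathcal S\otimes M_n(\mathbb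 C)$ is regarded as an operator system on $\mathcal H\otimes\mathbb C^n$. The map $\Phi$ is completely positive (respectively, completely isometric) if every $\Phi\otimes\mathrm{id}_n$, $n\ge1$, is positive (respectively, isometric for the operator norms), and self-adjoint if $\Phi(E^*)=\Phi(E)^*$ for all $E\in\mathcal S$. **Theorem.** Let $\Phi:\mathcal S\to\mathcal S'$ be a bounded linear map between operator systems that is unital and self-adjoint, and suppose that $\Phi$ is a section of a unital completely positive map, that is, there is a unital completely positive linear map $\Psi:\mathcal S'\to\mathcal S$ with $\Psi\circ\Phi=\mathrm{id}_{\mathcal S}$. Then $\|\Phi\|_{\mathrm{cbsdiam}}=1$ if and only if $\Phi$ is completely isometric. -/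

import Mathlib

open scoped ENNReal InnerProductSpace

namespace NumDiam

noncomputable section

/-- The numerical range `W(E) = {⟨E v, v⟩ / ⟨v, v⟩ : v ≠ 0}` (Mathlib's inner product is linear in
its second argument). -/
def numericalRange {H : Type*} [NormedAddCommGroup H] [InnerProductSpace ℂ H]
    (E : H →L[ℂ] H) : Set ℂ :=
  {z : ℂ | ∃ v : H, v ≠ 0 ∧ z = ⟪v, E v⟫_ℂ / ⟪v, v⟫_ℂ}

/-- The numerical diameter of a bounded operator: the diameter of its numerical range. -/
def opDiam {H : Type*} [NormedAddCommGroup H] [InnerProductSpace ℂ H]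
    (E : H →L[ℂ] H) : ℝ≥0∞ :=
  Metric.ediam (numericalRange E)

/-- A (concrete) operator system: a norm-closed, self-adjoint, unital subspace of `B(H)`. -/
structure OperatorSystem (H : Type*) [NormedAddCommGroup H] [InnerProductSpace ℂ H]
    [CompleteSpace H] extends Submodule ℂ (H →L[ℂ] H) where
  one_mem' : (1 : H →L[ℂ] H) ∈ carrier
  star_mem' : ∀ T ∈ carrier, star T ∈ carrier
  isClosed' : IsClosed carrier

instance {H : Type*} [NormedAddCommGroup H] [InnerProductSpace ℂ H] [CompleteSpace H] :
    CoeSort (OperatorSystem H) (Type _) :=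
  ⟨fun S => S.toSubmodule⟩

/-- The unit of an operator system. -/
def OperatorSystem.unit {H : Type*} [NormedAddCommGroup H] [InnerProductSpace ℂ H]
    [CompleteSpace H] (S : OperatorSystem H) : S :=
  ⟨1, S.one_mem'⟩

/-- The adjoint of an element of an operator system. -/
def OperatorSystem.adj {H : Type*} [NormedAddCommGroup H] [InnerProductSpace ℂ H]
    [CompleteSpace H] (S : OperatorSystem H) (E : S) : S :=
  ⟨star (E : H →L[ℂ] H), S.star_mem' _ E.2⟩

/-- The Hilbert space `H ⊗ ℂⁿ`, as the `ℓ²`-direct sum of `n` copies of `H`. -/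
abbrev HilbertSum (H : Type*) (n : ℕ) : Type _ := PiLp 2 (fun _ : Fin n => H)

/-- The projection of `H ⊗ ℂⁿ` onto its `i`-th summand. -/
def coordProj (H : Type*) [NormedAddCommGroup H] [InnerProductSpace ℂ H] (n : ℕ) (i : Fin n) :
    HilbertSum H n →L[ℂ] H :=
  PiLp.proj 2 (fun _ : Fin n => H) i

/-- The inclusion of the `i`-th summand into `H ⊗ ℂⁿ`. -/
def coordIncl (H : Type*) [NormedAddCommGroup H] [InnerProductSpace ℂ H] (n : ℕ) (i : Fin n) :
    H →L[ℂ] HilbertSum H n :=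
  LinearMap.mkContinuous
    { toFun := fun x => PiLp.single 2 i x
      map_add' := fun x y => PiLp.single_add 2 i
      map_smul' := fun c x => by
        ext j
        by_cases h : j = i
        · subst h; simp
        · simp }
    1 (fun x => by simp)

/-- The `(i, j)` entry of an operator on `H ⊗ ℂⁿ`, viewed as an `n × n` matrix over `B(H)`. -/
def entry {H : Type*} [NormedAddCommGroup H] [InnerProductSpace ℂ H] {n : ℕ}
    (T : HilbertSum H n →L[ℂ] HilbertSum H n) (i j : Fin n) : H →L[ℂ] H :=
  coordProj H n i ∘L T ∘L coordIncl H n j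

section facts

variable {H : Type*} [NormedAddCommGroup H] [InnerProductSpace ℂ H] {n : ℕ}

theorem coordProj_comp_coordIncl (i j : Fin n) :
    coordProj H n i ∘L coordIncl H n j = if i = j then 1 else 0 := by
  ext x
  by_cases h : i = j
  · subst h; simp [coordProj, coordIncl]
  · simp [coordProj, coordIncl, h]

theorem adjoint_coordProj [CompleteSpace H] (i : Fin n) :
    ContinuousLinearMap.adjoint (coordProj H n i) = coordIncl H n i := by
  symm
  rw [ContinuousLinearMap.eq_adjoint_iff]
  intro x y
  rw [PiLp.inner_apply, Finset.sum_eq_single i]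
  · simp [coordProj, coordIncl]
  · intro b _ hb
    simp [coordIncl, hb]
  · simp

theorem entry_star [CompleteSpace H] (T : HilbertSum H n →L[ℂ] HilbertSum H n) (i j : Fin n) :
    entry (star T) i j = star (entry T j i) := by
  simp only [entry, ContinuousLinearMap.star_eq_adjoint, ContinuousLinearMap.adjoint_comp,
    ← adjoint_coordProj, ContinuousLinearMap.adjoint_adjoint]
  rfl

theorem continuous_entry (i j : Fin n) :
    Continuous fun T : HilbertSum H n →L[ℂ] HilbertSum H n => entry T i j := by
  unfold entry
  fun_prop

end facts

/-- `Mₙ(S) = S ⊗ Mₙ(ℂ)`, as an operator system on `H ⊗ ℂⁿ`: the operators all of whose matrix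
entries lie in `S`. -/
def OperatorSystem.matrix {H : Type*} [NormedAddCommGroup H] [InnerProductSpace ℂ H]
    [CompleteSpace H] (S : OperatorSystem H) (n : ℕ) : OperatorSystem (HilbertSum H n) where
  carrier := {T | ∀ i j, entry T i j ∈ S.toSubmodule}
  add_mem' := fun {A B} hA hB i j => by
    have h : entry (A + B) i j = entry A i j + entry B i j := by
      simp [entry, ContinuousLinearMap.add_comp, ContinuousLinearMap.comp_add]
    rw [h]
    exact S.toSubmodule.add_mem (hA i j) (hB i j)
  zero_mem' := fun i j => by
    have h : entry (0 : HilbertSum H n →L[ℂ] HilbertSum H n) i j = 0 := by simp [entry]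
    rw [h]
    exact S.toSubmodule.zero_mem
  smul_mem' := fun c A hA i j => by
    have h : entry (c • A) i j = c • entry A i j := by
      simp [entry, ContinuousLinearMap.smul_comp]
    rw [h]
    exact S.toSubmodule.smul_mem c (hA i j)
  one_mem' := fun i j => by
    have h : entry (1 : HilbertSum H n →L[ℂ] HilbertSum H n) i j = if i = j then 1 else 0 :=
      coordProj_comp_coordIncl i j
    rw [h]
    split_ifs
    · exact S.one_mem'
    · exact S.toSubmodule.zero_mem
  star_mem' := fun T hT i j => by
    rw [entry_star]
    exact S.star_mem' _ (hT j i)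
  isClosed' := by
    have h : {T : HilbertSum H n →L[ℂ] HilbertSum H n | ∀ i j, entry T i j ∈ S.toSubmodule} =
        ⋂ i, ⋂ j, (fun T => entry T i j) ⁻¹' S.carrier := by
      ext T
      simp
    exact h ▸ isClosed_iInter fun i => isClosed_iInter fun j =>
      S.isClosed'.preimage (continuous_entry i j)

section maps

variable {H : Type*} [NormedAddCommGroup H] [InnerProductSpace ℂ H] [CompleteSpace H]
  {K : Type*} [NormedAddCommGroup K] [InnerProductSpace ℂ K] [CompleteSpace K]
  {S : OperatorSystem H} {S' : OperatorSystem K}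

/-- The operator on `K ⊗ ℂⁿ` whose `(i, j)` entry is `Φ` of the `(i, j)` entry of `T`. -/
def amplifyFun (Φ : S →ₗ[ℂ] S') (n : ℕ) (T : S.matrix n) :
    HilbertSum K n →L[ℂ] HilbertSum K n :=
  ∑ i, ∑ j, coordIncl K n i ∘L (Φ ⟨entry T.1 i j, T.2 i j⟩ : K →L[ℂ] K) ∘L coordProj K n j

theorem entry_amplifyFun (Φ : S →ₗ[ℂ] S') (n : ℕ) (T : S.matrix n) (i j : Fin n) :
    entry (amplifyFun Φ n T) i j = (Φ ⟨entry T.1 i j, T.2 i j⟩ : K →L[ℂ] K) := by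
  have hp : ∀ (a b : Fin n) (x : K),
      coordProj K n a (coordIncl K n b x) = if a = b then x else 0 := by
    intro a b x
    have := congrArg (fun f : K →L[ℂ] K => f x) (coordProj_comp_coordIncl (H := K) a b)
    simp only [ContinuousLinearMap.comp_apply] at this
    rw [this]
    split_ifs <;> simp
  ext x
  simp only [entry, amplifyFun, ContinuousLinearMap.comp_apply, sum_apply,
    map_sum, hp]
  rw [Finset.sum_eq_single i, Finset.sum_eq_single j]
  · simp
  · intro b _ hb
    simp [hb]
  · simp
  · intro b _ hb
    simp [hb.symm]
  · simp

/-- The amplification `Φ ⊗ idₙ : Mₙ(S) → Mₙ(S')`, which applies `Φ` to every matrix entry. -/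
def amplify (Φ : S →ₗ[ℂ] S') (n : ℕ) : S.matrix n →ₗ[ℂ] S'.matrix n where
  toFun T := ⟨amplifyFun Φ n T, fun i j => by
    rw [entry_amplifyFun]
    exact (Φ ⟨entry T.1 i j, T.2 i j⟩).2⟩
  map_add' A B := by
    apply Subtype.ext
    change amplifyFun Φ n (A + B) = amplifyFun Φ n A + amplifyFun Φ n B
    simp only [amplifyFun, ← Finset.sum_add_distrib]
    refine Finset.sum_congr rfl fun i _ => Finset.sum_congr rfl fun j _ => ?_
    have h : (⟨entry (A + B).1 i j, (A + B).2 i j⟩ : S) =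
        (⟨entry A.1 i j, A.2 i j⟩ : S) + ⟨entry B.1 i j, B.2 i j⟩ := by
      apply Subtype.ext
      simp [entry, ContinuousLinearMap.add_comp, ContinuousLinearMap.comp_add]
    rw [h, map_add]
    simp [ContinuousLinearMap.add_comp, ContinuousLinearMap.comp_add]
  map_smul' c A := by
    apply Subtype.ext
    change amplifyFun Φ n (c • A) = c • amplifyFun Φ n A
    simp only [amplifyFun, Finset.smul_sum]
    refine Finset.sum_congr rfl fun i _ => Finset.sum_congr rfl fun j _ => ?_
    have h : (⟨entry (c • A).1 i j, (c • A).2 i j⟩ : S) =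
        c • (⟨entry A.1 i j, A.2 i j⟩ : S) := by
      apply Subtype.ext
      simp [entry, ContinuousLinearMap.smul_comp]
    rw [h, map_smul]
    simp [ContinuousLinearMap.smul_comp]

/-- `Φ` is unital. -/
def IsUnital (Φ : S →ₗ[ℂ] S') : Prop := Φ S.unit = S'.unit

/-- `Φ` is self-adjoint: `Φ(E*) = Φ(E)*`. -/
def IsSelfAdjointMap (Φ : S →ₗ[ℂ] S') : Prop := ∀ E : S, Φ (S.adj E) = S'.adj (Φ E)

/-- `Φ` is positive: it maps positive operators to positive operators. -/
def IsPositiveMap (Φ : S →ₗ[ℂ] S') : Prop :=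
  ∀ E : S, (E : H →L[ℂ] H).IsPositive → (Φ E : K →L[ℂ] K).IsPositive

/-- `Φ` is completely positive: `Φ ⊗ idₙ` is positive for every `n ≥ 1`. -/
def IsCompletelyPositive (Φ : S →ₗ[ℂ] S') : Prop :=
  ∀ n : ℕ, 1 ≤ n → IsPositiveMap (amplify Φ n)

/-- `Φ` is completely isometric: `Φ ⊗ idₙ` is isometric (for operator norms) for every `n ≥ 1`. -/
def IsCompletelyIsometric (Φ : S →ₗ[ℂ] S') : Prop :=
  ∀ n : ℕ, 1 ≤ n → Isometry (amplify Φ n)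

/-- The self-adjoint numerical diameter of `Φ`: the supremum in `[0, ∞]` of
`‖Φ(E)‖_diam / ‖E‖_diam` over the self-adjoint `E ∈ S` that are not scalar multiples of the unit.
-/
def sdiam (Φ : S →ₗ[ℂ] S') : ℝ≥0∞ :=
  ⨆ (E : S) (_ : IsSelfAdjoint (E : H →L[ℂ] H)) (_ : ∀ c : ℂ, (E : H →L[ℂ] H) ≠ c • 1),
    opDiam (Φ E : K →L[ℂ] K) / opDiam (E : H →L[ℂ] H)

/-- The completely bounded self-adjoint numerical diameter, `sup_{n ≥ 1} ‖Φ ⊗ idₙ‖_sdiam`. -/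
def cbsdiam (Φ : S →ₗ[ℂ] S') : ℝ≥0∞ :=
  ⨆ (n : ℕ) (_ : 1 ≤ n), sdiam (amplify Φ n)

end maps

end

end NumDiam

namespace NumDiam

noncomputable section

open ContinuousLinearMap (adjoint)

/-! ### Numerical diameter, norm and positivity of a single operator. -/

section numericalRange

variable {H : Type*} [NormedAddCommGroup H] [InnerProductSpace ℂ H]

/-! Two facts link numerical diameters to norms. First, the numerical diameter of a self-adjoint
operator is twice its distance to the scalars (`opDiam_le_of_norm_sub_le`,
`exists_norm_sub_le_of_opDiam_le`). A unital self-adjoint isometry preserves that distance, so every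
ratio in the definition of `cbsdiam` is 1 when `Φ` is completely isometric.

Second, an arbitrary `A` is encoded by the self-adjoint matrix `[[0, A], [A*, 0]]`, which has norm
`‖A‖` and numerical diameter `2‖A‖` (`norm_offDiag_le`, `two_mul_norm_le_opDiam_offDiag`).
Amplification commutes with this construction (`amplify_offDiag`), so `cbsdiam Φ ≤ 1` at size `2n`
makes `Φ ⊗ idₙ` contractive on all of `Mₙ(S)`. The same trick makes the unital completely positive
`Ψ` completely contractive, and `Ψ ∘ Φ = id` gives the reverse inequality `‖E‖ ≤ ‖(Φ ⊗ idₙ) E‖`. -/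

theorem inner_self_eq_ofReal_norm_sq (v : H) : ⟪v, v⟫_ℂ = ((‖v‖ ^ 2 : ℝ) : ℂ) := by
  rw [Complex.ofReal_pow]
  exact inner_self_eq_norm_sq_to_K v

theorem isSelfAdjoint_ofReal_smul_one [CompleteSpace H] (r : ℝ) :
    IsSelfAdjoint ((r : ℂ) • (1 : H →L[ℂ] H)) := by
  rw [IsSelfAdjoint, star_smul, star_one]
  congr 1
  exact Complex.conj_ofReal _

/-- Subtracting `c • 1` translates the numerical range by `-c`; Cauchy-Schwarz does the rest. -/
theorem norm_sub_le_of_mem_numericalRange {T : H →L[ℂ] H} {c z : ℂ} {r : ℝ}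
    (hT : ‖T - c • 1‖ ≤ r) (hz : z ∈ numericalRange T) : ‖z - c‖ ≤ r := by
  obtain ⟨v, hv, rfl⟩ := hz
  have hv' : ⟪v, v⟫_ℂ ≠ 0 := inner_self_ne_zero.2 hv
  have hpos : 0 < ‖v‖ := norm_pos_iff.2 hv
  have h : ⟪v, T v⟫_ℂ / ⟪v, v⟫_ℂ - c = ⟪v, (T - c • 1) v⟫_ℂ / ⟪v, v⟫_ℂ := by
    simp only [sub_apply, smul_apply,
      one_apply_eq_self, inner_sub_right, inner_smul_right]
    field_simp
  rw [h, norm_div, inner_self_eq_ofReal_norm_sq, Complex.norm_real, Real.norm_eq_abs,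
    abs_of_nonneg (sq_nonneg _), div_le_iff₀ (by positivity)]
  calc ‖⟪v, (T - c • 1) v⟫_ℂ‖ ≤ ‖v‖ * ‖(T - c • 1) v‖ := norm_inner_le_norm _ _
    _ ≤ ‖v‖ * (r * ‖v‖) := by
        gcongr
        exact (T - c • 1).le_of_opNorm_le hT v
    _ = r * ‖v‖ ^ 2 := by ring

theorem opDiam_le_of_norm_sub_le {T : H →L[ℂ] H} {c : ℂ} {r : ℝ} (hT : ‖T - c • 1‖ ≤ r) :
    opDiam T ≤ ENNReal.ofReal (2 * r) := by
  refine Metric.ediam_le fun z hz w hw => ?_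
  rw [edist_dist]
  refine ENNReal.ofReal_le_ofReal ?_
  have h1 := norm_sub_le_of_mem_numericalRange hT hz
  have h2 := norm_sub_le_of_mem_numericalRange hT hw
  rw [dist_eq_norm]
  calc ‖z - w‖ = ‖(z - c) - (w - c)‖ := by congr 1; ring
    _ ≤ ‖z - c‖ + ‖w - c‖ := norm_sub_le _ _
    _ ≤ 2 * r := by linarith

theorem opDiam_le_two_mul_norm (T : H →L[ℂ] H) : opDiam T ≤ ENNReal.ofReal (2 * ‖T‖) :=
  opDiam_le_of_norm_sub_le (c := 0) (by simp)

theorem opDiam_ne_top (T : H →L[ℂ] H) : opDiam T ≠ ∞ :=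
  ne_top_of_le_ne_top ENNReal.ofReal_ne_top (opDiam_le_two_mul_norm T)

variable [CompleteSpace H]

/-- The norm of a self-adjoint operator is controlled by its quadratic form. -/
theorem norm_le_of_abs_re_inner_le {T : H →L[ℂ] H} (hT : IsSelfAdjoint T) {r : ℝ} (hr : 0 ≤ r)
    (h : ∀ v : H, |(⟪v, T v⟫_ℂ).re| ≤ r * ‖v‖ ^ 2) : ‖T‖ ≤ r := by
  rw [T.norm_eq_iSup_rayleighQuotient hT.isSymmetric]
  refine Real.iSup_le (fun v => ?_) hr
  rw [ContinuousLinearMap.rayleighQuotient, abs_div, abs_of_nonneg (sq_nonneg ‖v‖)]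
  refine div_le_of_le_mul₀ (sq_nonneg _) hr ?_
  have : T.reApplyInnerSelf v = (⟪v, T v⟫_ℂ).re := by
    rw [ContinuousLinearMap.reApplyInnerSelf_apply, inner_re_symm]
    rfl
  rw [this]
  exact h v

theorem im_eq_zero_of_mem_numericalRange {T : H →L[ℂ] H} (hT : IsSelfAdjoint T) {z : ℂ}
    (hz : z ∈ numericalRange T) : z.im = 0 := by
  obtain ⟨v, -, rfl⟩ := hz
  have h : (starRingEnd ℂ) ⟪v, T v⟫_ℂ = ⟪v, T v⟫_ℂ := by
    rw [inner_conj_symm]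
    exact hT.isSymmetric v v
  rw [← Complex.conj_eq_iff_im, map_div₀, h, inner_conj_symm]

/-- A self-adjoint operator lies within half its numerical diameter of the scalars. -/
theorem exists_norm_sub_le_of_opDiam_le {T : H →L[ℂ] H} (hT : IsSelfAdjoint T) {r : ℝ}
    (hr : 0 ≤ r) (h : opDiam T ≤ ENNReal.ofReal (2 * r)) :
    ∃ c : ℝ, ‖T - (c : ℂ) • 1‖ ≤ r := by
  -- The numerical range of a self-adjoint operator is real, so its real parts retain all the
  -- information.
  set R : Set ℝ := Complex.re '' numericalRange T
  have hbdd : Bornology.IsBounded R := by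
    refine Metric.isBounded_iff_subset_closedBall 0 |>.2 ⟨‖T‖, ?_⟩
    rintro _ ⟨z, hz, rfl⟩
    have := norm_sub_le_of_mem_numericalRange (T := T) (c := 0) (r := ‖T‖) (by simp) hz
    rw [mem_closedBall_zero_iff, Real.norm_eq_abs]
    exact (Complex.abs_re_le_norm z).trans (by simpa using this)
  have hdiam : sSup R - sInf R ≤ 2 * r := by
    rw [← ENNReal.ofReal_le_ofReal_iff (by positivity), ← Real.ediam_eq hbdd]
    refine (Metric.ediam_le ?_).trans h
    rintro _ ⟨z, hz, rfl⟩ _ ⟨w, hw, rfl⟩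
    refine le_trans ?_ (Metric.edist_le_ediam_of_mem hz hw)
    rw [edist_dist, edist_dist]
    refine ENNReal.ofReal_le_ofReal ?_
    rw [Real.dist_eq, dist_eq_norm, ← Complex.sub_re]
    exact Complex.abs_re_le_norm _
  -- The optimal scalar is the midpoint of the interval spanned by the numerical range.
  refine ⟨(sSup R + sInf R) / 2, norm_le_of_abs_re_inner_le
    (hT.sub (isSelfAdjoint_ofReal_smul_one _)) hr fun v => ?_⟩
  by_cases hv : v = 0
  · simp [hv]
  have hv' : ⟪v, v⟫_ℂ ≠ 0 := inner_self_ne_zero.2 hv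
  have hz : ⟪v, T v⟫_ℂ / ⟪v, v⟫_ℂ ∈ numericalRange T := ⟨v, hv, rfl⟩
  have hmem := hbdd.subset_Icc_sInf_sSup ⟨_, hz, rfl⟩
  have him := im_eq_zero_of_mem_numericalRange hT hz
  set z := ⟪v, T v⟫_ℂ / ⟪v, v⟫_ℂ with hzdef
  have hTv : ⟪v, T v⟫_ℂ = z.re * ((‖v‖ ^ 2 : ℝ) : ℂ) := by
    have h1 : (z.re : ℂ) = z := by
      apply Complex.ext <;> simp [him]
    rw [h1, hzdef]
    rw [← inner_self_eq_ofReal_norm_sq, div_mul_cancel₀ _ hv']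
  have key : (⟪v, (T - (((sSup R + sInf R) / 2 : ℝ) : ℂ) • 1) v⟫_ℂ).re =
      (z.re - (sSup R + sInf R) / 2) * ‖v‖ ^ 2 := by
    simp only [sub_apply, smul_apply,
      one_apply_eq_self, inner_sub_right, inner_smul_right, hTv,
      inner_self_eq_ofReal_norm_sq]
    rw [← Complex.ofReal_mul, ← Complex.ofReal_mul, ← Complex.ofReal_sub, Complex.ofReal_re,
      sub_mul]
  rw [key, abs_mul, abs_of_nonneg (sq_nonneg ‖v‖)]
  gcongr
  rw [abs_le]
  constructor <;> linarith [hmem.1, hmem.2]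

/-- Diameter zero means distance zero from the scalars. This keeps `0 / 0 = 0` in `ℝ≥0∞` out of the
ratios defining `sdiam`. -/
theorem opDiam_ne_zero {T : H →L[ℂ] H} (hT : IsSelfAdjoint T)
    (hns : ∀ c : ℂ, T ≠ c • 1) : opDiam T ≠ 0 := by
  intro h0
  obtain ⟨c, hc⟩ := exists_norm_sub_le_of_opDiam_le hT le_rfl (by simp [h0])
  exact hns c (sub_eq_zero.1 (norm_le_zero_iff.1 hc))

/-- The norm of a self-adjoint `T` is at most `r` as soon as `r ± T` are positive. -/
theorem norm_le_of_isPositive {T : H →L[ℂ] H} {r : ℝ} (hr : 0 ≤ r)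
    (h₁ : ((r : ℂ) • 1 + T).IsPositive) (h₂ : ((r : ℂ) • 1 - T).IsPositive) : ‖T‖ ≤ r := by
  have hsa : IsSelfAdjoint T := by
    simpa using h₁.isSelfAdjoint.sub (isSelfAdjoint_ofReal_smul_one r)
  refine norm_le_of_abs_re_inner_le hsa hr fun v => ?_
  have a := h₁.re_inner_nonneg_right v
  have b := h₂.re_inner_nonneg_right v
  have hv : (⟪v, v⟫_ℂ).re = ‖v‖ ^ 2 := inner_self_eq_norm_sq (𝕜 := ℂ) v
  simp only [add_apply, sub_apply, smul_apply, one_apply_eq_self, inner_add_right,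
    inner_sub_right, inner_smul_right, RCLike.re_eq_complex_re, Complex.add_re, Complex.sub_re,
    Complex.re_ofReal_mul, hv] at a b
  rw [abs_le]
  constructor <;> linarith

theorem isPositive_of_norm_le {T : H →L[ℂ] H} (hT : IsSelfAdjoint T) {r : ℝ} (h : ‖T‖ ≤ r) :
    ((r : ℂ) • 1 + T).IsPositive := by
  rw [ContinuousLinearMap.isPositive_def']
  refine ⟨(isSelfAdjoint_ofReal_smul_one r).add hT, fun v => ?_⟩
  have hv : (⟪v, v⟫_ℂ).re = ‖v‖ ^ 2 := inner_self_eq_norm_sq (𝕜 := ℂ) v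
  rw [ContinuousLinearMap.reApplyInnerSelf_apply, inner_re_symm]
  simp only [add_apply, smul_apply, one_apply_eq_self, inner_add_right,
    inner_smul_right, RCLike.re_eq_complex_re, Complex.add_re, Complex.re_ofReal_mul, hv]
  have h1 : |(⟪v, T v⟫_ℂ).re| ≤ ‖v‖ * (r * ‖v‖) :=
    (Complex.abs_re_le_norm _).trans <| (norm_inner_le_norm _ _).trans <| by
      gcongr
      exact T.le_of_opNorm_le h v
  have := (abs_le.1 h1).1
  nlinarith

end numericalRange

/-! ### The self-adjoint off-diagonal dilation on two copies of `H ⊗ ℂⁿ`. -/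

section dilation

variable {H : Type*} [NormedAddCommGroup H] [InnerProductSpace ℂ H] {n : ℕ}

@[simp]
theorem coordProj_apply (i : Fin n) (v : HilbertSum H n) : coordProj H n i v = v i := rfl

@[simp]
theorem coordIncl_apply (i : Fin n) (x : H) : coordIncl H n i x = PiLp.single 2 i x := rfl

/-- The operator that reads off the coordinates listed by `f`. -/
def reindexProj (H : Type*) [NormedAddCommGroup H] [InnerProductSpace ℂ H] {n m : ℕ}
    (f : Fin n → Fin m) : HilbertSum H m →L[ℂ] HilbertSum H n :=
  ∑ i, coordIncl H n i ∘L coordProj H m (f i)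

theorem reindexProj_apply {m : ℕ} (f : Fin n → Fin m) (v : HilbertSum H m) (i : Fin n) :
    reindexProj H f v i = v (f i) := by
  simp [reindexProj, Pi.single_apply]

/-- The projection of `H ⊗ ℂ²ⁿ` onto its first `n` coordinates. -/
def topProj (H : Type*) [NormedAddCommGroup H] [InnerProductSpace ℂ H] (n : ℕ) :
    HilbertSum H (n + n) →L[ℂ] HilbertSum H n :=
  reindexProj H (Fin.castAdd n)

/-- The projection of `H ⊗ ℂ²ⁿ` onto its last `n` coordinates. -/
def botProj (H : Type*) [NormedAddCommGroup H] [InnerProductSpace ℂ H] (n : ℕ) :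
    HilbertSum H (n + n) →L[ℂ] HilbertSum H n :=
  reindexProj H (Fin.natAdd n)

theorem norm_sq_eq_topProj_add_botProj (v : HilbertSum H (n + n)) :
    ‖v‖ ^ 2 = ‖topProj H n v‖ ^ 2 + ‖botProj H n v‖ ^ 2 := by
  simp only [PiLp.norm_sq_eq_of_L2, Fin.sum_univ_add, topProj, botProj, reindexProj_apply]

theorem hilbertSum_ext {T T' : HilbertSum H n →L[ℂ] HilbertSum H n}
    (h : ∀ i j, entry T i j = entry T' i j) : T = T' := by
  have hid : ∀ v : HilbertSum H n, v = ∑ j, coordIncl H n j (v j) := by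
    intro v
    ext i
    simp [Pi.single_apply]
  ext v i
  rw [hid v, map_sum, map_sum, WithLp.ofLp_sum, WithLp.ofLp_sum, Finset.sum_apply,
    Finset.sum_apply]
  exact Finset.sum_congr rfl fun j _ => congrArg (fun f : H →L[ℂ] H => f (v j)) (h i j)

theorem reindexProj_comp_coordIncl {m : ℕ} {f : Fin n → Fin m} (hf : Function.Injective f)
    (i : Fin n) : reindexProj H f ∘L coordIncl H m (f i) = coordIncl H n i := by
  ext x j
  simp [reindexProj_apply, hf.eq_iff]

theorem reindexProj_comp_coordIncl_of_ne {m : ℕ} {f : Fin n → Fin m} {k : Fin m}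
    (hk : ∀ i, f i ≠ k) : reindexProj H f ∘L coordIncl H m k = 0 := by
  ext x j
  simp [reindexProj_apply, hk]

variable [CompleteSpace H]

theorem coordProj_comp_adjoint_reindexProj {m : ℕ} {f : Fin n → Fin m}
    (hf : Function.Injective f) (i : Fin n) :
    coordProj H m (f i) ∘L adjoint (reindexProj H f) = coordProj H n i := by
  have h := congrArg adjoint (reindexProj_comp_coordIncl (H := H) hf i)
  simpa only [ContinuousLinearMap.adjoint_comp, ← adjoint_coordProj,
    ContinuousLinearMap.adjoint_adjoint] using h

theorem coordProj_comp_adjoint_reindexProj_of_ne {m : ℕ} {f : Fin n → Fin m} {k : Fin m}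
    (hk : ∀ i, f i ≠ k) : coordProj H m k ∘L adjoint (reindexProj H f) = 0 := by
  have h := congrArg adjoint (reindexProj_comp_coordIncl_of_ne (H := H) hk)
  simpa only [ContinuousLinearMap.adjoint_comp, ← adjoint_coordProj,
    ContinuousLinearMap.adjoint_adjoint, map_zero] using h

theorem natAdd_ne_castAdd (i j : Fin n) : Fin.natAdd n i ≠ Fin.castAdd n j := by
  intro h
  have := congrArg Fin.val h
  simp at this
  omega

theorem castAdd_ne_natAdd (i j : Fin n) : Fin.castAdd n i ≠ Fin.natAdd n j :=
  (natAdd_ne_castAdd j i).symm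

theorem topProj_adjoint_topProj (v : HilbertSum H n) :
    topProj H n (adjoint (topProj H n) v) = v := by
  ext i
  rw [topProj, reindexProj_apply]
  exact congrArg (fun f : HilbertSum H n →L[ℂ] H => f v)
    (coordProj_comp_adjoint_reindexProj (H := H) (Fin.castAdd_injective n n) i)

theorem botProj_adjoint_botProj (v : HilbertSum H n) :
    botProj H n (adjoint (botProj H n) v) = v := by
  ext i
  rw [botProj, reindexProj_apply]
  exact congrArg (fun f : HilbertSum H n →L[ℂ] H => f v)
    (coordProj_comp_adjoint_reindexProj (H := H) (Fin.natAdd_injective n n) i)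

theorem topProj_adjoint_botProj (v : HilbertSum H n) :
    topProj H n (adjoint (botProj H n) v) = 0 := by
  ext i
  rw [topProj, reindexProj_apply]
  exact congrArg (fun f : HilbertSum H n →L[ℂ] H => f v)
    (coordProj_comp_adjoint_reindexProj_of_ne (H := H) fun j => natAdd_ne_castAdd j i)

theorem botProj_adjoint_topProj (v : HilbertSum H n) :
    botProj H n (adjoint (topProj H n) v) = 0 := by
  ext i
  rw [botProj, reindexProj_apply]
  exact congrArg (fun f : HilbertSum H n →L[ℂ] H => f v)
    (coordProj_comp_adjoint_reindexProj_of_ne (H := H) fun j => castAdd_ne_natAdd j i)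

/-- The operator matrix with zero diagonal blocks and off-diagonal blocks `A` and `B`. -/
def offDiag (A B : HilbertSum H n →L[ℂ] HilbertSum H n) :
    HilbertSum H (n + n) →L[ℂ] HilbertSum H (n + n) :=
  adjoint (topProj H n) ∘L A ∘L botProj H n + adjoint (botProj H n) ∘L B ∘L topProj H n

theorem inner_offDiag (A B : HilbertSum H n →L[ℂ] HilbertSum H n) (v : HilbertSum H (n + n)) :
    ⟪v, offDiag A B v⟫_ℂ =
      ⟪topProj H n v, A (botProj H n v)⟫_ℂ + ⟪botProj H n v, B (topProj H n v)⟫_ℂ := by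
  simp only [offDiag, add_apply, ContinuousLinearMap.comp_apply, inner_add_right,
    ContinuousLinearMap.adjoint_inner_right]

theorem isSelfAdjoint_offDiag (A : HilbertSum H n →L[ℂ] HilbertSum H n) :
    IsSelfAdjoint (offDiag A (star A)) := by
  rw [IsSelfAdjoint]
  simp only [offDiag, ContinuousLinearMap.star_eq_adjoint, map_add,
    ContinuousLinearMap.adjoint_comp, ContinuousLinearMap.adjoint_adjoint]
  exact add_comm _ _

theorem topProj_offDiag_adjoint_botProj (A B : HilbertSum H n →L[ℂ] HilbertSum H n)
    (v : HilbertSum H n) : topProj H n (offDiag A B (adjoint (botProj H n) v)) = A v := by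
  simp [offDiag, botProj_adjoint_botProj, topProj_adjoint_topProj, topProj_adjoint_botProj]

theorem norm_adjoint_botProj (v : HilbertSum H n) : ‖adjoint (botProj H n) v‖ = ‖v‖ := by
  rw [← sq_eq_sq₀ (norm_nonneg _) (norm_nonneg _), norm_sq_eq_topProj_add_botProj,
    botProj_adjoint_botProj, topProj_adjoint_botProj]
  simp

/-- `A` is a corner of the block matrix, and cutting down to a corner cannot increase the norm. -/
theorem norm_le_norm_offDiag (A B : HilbertSum H n →L[ℂ] HilbertSum H n) :
    ‖A‖ ≤ ‖offDiag A B‖ := by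
  refine A.opNorm_le_bound (norm_nonneg _) fun v => ?_
  rw [← topProj_offDiag_adjoint_botProj A B v, ← norm_adjoint_botProj v]
  refine le_trans ?_ ((offDiag A B).le_opNorm _)
  rw [← sq_le_sq₀ (norm_nonneg _) (norm_nonneg _),
    norm_sq_eq_topProj_add_botProj (offDiag A B (adjoint (botProj H n) v))]
  linarith [sq_nonneg ‖botProj H n (offDiag A B (adjoint (botProj H n) v))‖]

theorem norm_offDiag_le (A : HilbertSum H n →L[ℂ] HilbertSum H n) :
    ‖offDiag A (star A)‖ ≤ ‖A‖ := by
  refine norm_le_of_abs_re_inner_le (isSelfAdjoint_offDiag A) (norm_nonneg _) fun v => ?_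
  rw [inner_offDiag, norm_sq_eq_topProj_add_botProj v]
  set a := topProj H n v
  set b := botProj H n v
  have h1 : ‖⟪a, A b⟫_ℂ‖ ≤ ‖a‖ * (‖A‖ * ‖b‖) :=
    (norm_inner_le_norm _ _).trans (by gcongr; exact A.le_opNorm b)
  have h2 : ‖⟪b, (star A) a⟫_ℂ‖ ≤ ‖b‖ * (‖A‖ * ‖a‖) :=
    (norm_inner_le_norm _ _).trans (by
      gcongr
      rw [← norm_star A]
      exact (star A).le_opNorm a)
  have h3 := (Complex.abs_re_le_norm _).trans (norm_add_le ⟪a, A b⟫_ℂ ⟪b, (star A) a⟫_ℂ)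
  -- This is `2‖a‖‖b‖ ≤ ‖a‖² + ‖b‖²`, scaled by `‖A‖`.
  nlinarith [mul_nonneg (norm_nonneg A) (sq_nonneg (‖a‖ - ‖b‖))]

/-- Flipping the sign of one block component of a vector negates the quadratic form, so the
numerical range contains pairs `±‖A v‖ / ‖v‖`. -/
theorem two_mul_norm_le_opDiam_offDiag (A : HilbertSum H n →L[ℂ] HilbertSum H n) :
    ENNReal.ofReal (2 * ‖A‖) ≤ opDiam (offDiag A (star A)) := by
  have htop := opDiam_ne_top (offDiag A (star A))
  rw [ENNReal.ofReal_le_iff_le_toReal htop]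
  set d := (opDiam (offDiag A (star A))).toReal with hd
  suffices h : ‖A‖ ≤ d / 2 by linarith
  refine A.opNorm_le_bound (by positivity) fun v => ?_
  rcases eq_or_ne (A v) 0 with hA | hA
  · rw [hA, norm_zero]
    positivity
  have hv : v ≠ 0 := fun h => hA (by simp [h])
  have hvpos : 0 < ‖v‖ := norm_pos_iff.2 hv
  have hApos : 0 < ‖A v‖ := norm_pos_iff.2 hA
  -- `u` points along `A v` but has the length of `v`, so that `⟪u, A v⟫ = ‖v‖ ‖A v‖` is as large as
  -- possible.
  set u : HilbertSum H n := ((‖v‖ / ‖A v‖ : ℝ) : ℂ) • A v with hu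
  have hun : ‖u‖ = ‖v‖ := by
    rw [hu, norm_smul, Complex.norm_real, Real.norm_eq_abs, abs_of_nonneg (by positivity)]
    field_simp
  have huA : ⟪u, A v⟫_ℂ = ((‖v‖ * ‖A v‖ : ℝ) : ℂ) := by
    rw [hu, inner_smul_left, Complex.conj_ofReal, inner_self_eq_ofReal_norm_sq,
      ← Complex.ofReal_mul]
    congr 1
    field_simp
  clear_value u
  have hAu : ⟪v, (star A) u⟫_ℂ = ((‖v‖ * ‖A v‖ : ℝ) : ℂ) := by
    rw [ContinuousLinearMap.star_eq_adjoint, ContinuousLinearMap.adjoint_inner_right,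
      ← inner_conj_symm, huA, Complex.conj_ofReal]
  -- The test vector is `(u, ε v)` with `ε = ±1`.
  have key : ∀ ε : ℝ, ε ^ 2 = 1 →
      ((ε * (‖A v‖ / ‖v‖) : ℝ) : ℂ) ∈ numericalRange (offDiag A (star A)) := by
    intro ε hε
    set x : HilbertSum H (n + n) :=
      adjoint (topProj H n) u + adjoint (botProj H n) ((ε : ℂ) • v) with hx
    have ht : topProj H n x = u := by
      rw [hx, map_add, topProj_adjoint_topProj, topProj_adjoint_botProj, add_zero]
    have hb : botProj H n x = (ε : ℂ) • v := by
      rw [hx, map_add, botProj_adjoint_topProj, botProj_adjoint_botProj, zero_add]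
    have hnx : ‖x‖ ^ 2 = 2 * ‖v‖ ^ 2 := by
      rw [norm_sq_eq_topProj_add_botProj, ht, hb, hun, norm_smul, mul_pow, Complex.norm_real,
        Real.norm_eq_abs, sq_abs, hε]
      ring
    refine ⟨x, ?_, ?_⟩
    · rintro h0
      rw [h0] at hnx
      simp at hnx
      exact hv hnx
    · have hxx : ⟪x, x⟫_ℂ = ((2 * ‖v‖ ^ 2 : ℝ) : ℂ) := by
        rw [inner_self_eq_ofReal_norm_sq, hnx]
      rw [inner_offDiag, ht, hb, hxx, map_smul, inner_smul_right, inner_smul_left, huA, hAu,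
        Complex.conj_ofReal]
      rw [← Complex.ofReal_mul, ← Complex.ofReal_add, ← Complex.ofReal_div]
      congr 1
      field_simp
      ring
  have h := Metric.edist_le_ediam_of_mem (key 1 (by norm_num)) (key (-1) (by norm_num))
  change _ ≤ opDiam _ at h
  rw [edist_dist, ENNReal.ofReal_le_iff_le_toReal htop, dist_eq_norm, ← Complex.ofReal_sub,
    Complex.norm_real, Real.norm_eq_abs] at h
  have h' := (le_abs_self _).trans h
  rw [← hd] at h'
  have : ‖A v‖ / ‖v‖ ≤ d / 2 := by linarith
  rwa [div_le_iff₀ hvpos] at this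

theorem offDiag_ne_smul_one {A : HilbertSum H n →L[ℂ] HilbertSum H n} (hA : A ≠ 0)
    (B : HilbertSum H n →L[ℂ] HilbertSum H n) (c : ℂ) : offDiag A B ≠ c • 1 := by
  intro h
  apply hA
  ext1 v
  rw [← topProj_offDiag_adjoint_botProj A B v, h]
  simp [topProj_adjoint_botProj]

/-- The explicit block form reduces membership in `M₂ₙ(S)` and compatibility with amplification to
entrywise checks. -/
theorem entry_offDiag (A B : HilbertSum H n →L[ℂ] HilbertSum H n) (i j : Fin (n + n)) :
    entry (offDiag A B) i j =
      Fin.addCases (motive := fun _ => H →L[ℂ] H)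
        (fun i' => Fin.addCases (motive := fun _ => H →L[ℂ] H) (fun _ => 0)
          (fun j' => entry A i' j') j)
        (fun i' => Fin.addCases (motive := fun _ => H →L[ℂ] H) (fun j' => entry B i' j')
          (fun _ => 0) j) i := by
  have h : entry (offDiag A B) i j =
      (coordProj H (n + n) i ∘L adjoint (topProj H n)) ∘L A ∘L
        (botProj H n ∘L coordIncl H (n + n) j) +
      (coordProj H (n + n) i ∘L adjoint (botProj H n)) ∘L B ∘L
        (topProj H n ∘L coordIncl H (n + n) j) := by
    ext x
    simp only [entry, offDiag, ContinuousLinearMap.comp_apply, add_apply, map_add]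
  have p1 (i' : Fin n) := coordProj_comp_adjoint_reindexProj (H := H) (Fin.castAdd_injective n n) i'
  have p2 (i' : Fin n) := coordProj_comp_adjoint_reindexProj (H := H) (Fin.natAdd_injective n n) i'
  have p3 (i' : Fin n) := coordProj_comp_adjoint_reindexProj_of_ne (H := H)
    fun j : Fin n => natAdd_ne_castAdd j i'
  have p4 (i' : Fin n) := coordProj_comp_adjoint_reindexProj_of_ne (H := H)
    fun j : Fin n => castAdd_ne_natAdd j i'
  have q1 (i' : Fin n) := reindexProj_comp_coordIncl (H := H) (Fin.castAdd_injective n n) i'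
  have q2 (i' : Fin n) := reindexProj_comp_coordIncl (H := H) (Fin.natAdd_injective n n) i'
  have q3 (i' : Fin n) := reindexProj_comp_coordIncl_of_ne (H := H)
    fun j : Fin n => natAdd_ne_castAdd j i'
  have q4 (i' : Fin n) := reindexProj_comp_coordIncl_of_ne (H := H)
    fun j : Fin n => castAdd_ne_natAdd j i'
  rw [h]
  refine Fin.addCases (fun i' => ?_) (fun i' => ?_) i <;>
  refine Fin.addCases (fun j' => ?_) (fun j' => ?_) j <;>
  simp only [topProj, botProj, p1, p2, p3, p4, q1, q2, q3, q4, Fin.addCases_left,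
    Fin.addCases_right, entry, ContinuousLinearMap.comp_zero, ContinuousLinearMap.zero_comp,
    add_zero, zero_add]

end dilation

/-! ### Amplified maps: contractivity and preservation of numerical diameters. -/

section maps

variable {H : Type*} [NormedAddCommGroup H] [InnerProductSpace ℂ H] [CompleteSpace H]
  {K : Type*} [NormedAddCommGroup K] [InnerProductSpace ℂ K] [CompleteSpace K]
  {S : OperatorSystem H} {S' : OperatorSystem K} {n : ℕ}

/-- The off-diagonal `2n × 2n` matrix over an operator system built from two `n × n` matrices. -/
def OperatorSystem.offDiag (A B : S.matrix n) : S.matrix (n + n) :=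
  ⟨NumDiam.offDiag A.1 B.1, fun i j => by
    rw [entry_offDiag]
    refine Fin.addCases (fun i' => ?_) (fun i' => ?_) i <;>
    refine Fin.addCases (fun j' => ?_) (fun j' => ?_) j <;>
    simp only [Fin.addCases_left, Fin.addCases_right]
    · exact S.toSubmodule.zero_mem
    · exact A.2 i' j'
    · exact B.2 i' j'
    · exact S.toSubmodule.zero_mem⟩

theorem entry_amplify (Φ : S →ₗ[ℂ] S') (T : S.matrix n) (i j : Fin n) :
    entry (amplify Φ n T).1 i j = (Φ ⟨entry T.1 i j, T.2 i j⟩).1 :=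
  entry_amplifyFun Φ n T i j

/-- Amplification acts entrywise and linearity preserves the zero blocks. -/
theorem amplify_offDiag (Φ : S →ₗ[ℂ] S') (A B : S.matrix n) :
    amplify Φ (n + n) (OperatorSystem.offDiag A B) =
      OperatorSystem.offDiag (amplify Φ n A) (amplify Φ n B) := by
  apply Subtype.ext
  apply hilbertSum_ext
  intro i j
  have h0 : ∀ h, ((Φ ⟨0, h⟩ : S') : K →L[ℂ] K) = 0 := fun _ => by
    have h : Φ 0 = 0 := map_zero Φ
    exact congrArg Subtype.val h
  rw [entry_amplify]
  simp only [OperatorSystem.offDiag, entry_offDiag]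
  refine Fin.addCases (fun i' => ?_) (fun i' => ?_) i <;>
  refine Fin.addCases (fun j' => ?_) (fun j' => ?_) j <;>
  simp only [Fin.addCases_left, Fin.addCases_right, h0, entry_amplify]

theorem IsUnital.amplify {Φ : S →ₗ[ℂ] S'} (hΦ : IsUnital Φ) (n : ℕ) :
    IsUnital (amplify Φ n) := by
  apply Subtype.ext
  apply hilbertSum_ext
  intro i j
  rw [entry_amplify]
  change _ = entry (1 : HilbertSum K n →L[ℂ] HilbertSum K n) i j
  have h1 : entry (1 : HilbertSum K n →L[ℂ] HilbertSum K n) i j = if i = j then 1 else 0 :=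
    coordProj_comp_coordIncl i j
  have h2 : entry (S.matrix n).unit.1 i j = if i = j then 1 else 0 :=
    coordProj_comp_coordIncl i j
  rw [h1]
  split_ifs at h2 ⊢ with hij
  · have : (⟨entry (S.matrix n).unit.1 i j, (S.matrix n).unit.2 i j⟩ : S) = S.unit :=
      Subtype.ext h2
    rw [this, hΦ]
    rfl
  · have : (⟨entry (S.matrix n).unit.1 i j, (S.matrix n).unit.2 i j⟩ : S) = 0 :=
      Subtype.ext h2
    rw [this, map_zero]
    rfl

theorem IsSelfAdjointMap.amplify {Φ : S →ₗ[ℂ] S'} (hΦ : IsSelfAdjointMap Φ) (n : ℕ) :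
    IsSelfAdjointMap (amplify Φ n) := by
  intro E
  apply Subtype.ext
  apply hilbertSum_ext
  intro i j
  change _ = entry (star (NumDiam.amplify Φ n E).1) i j
  rw [entry_amplify, entry_star, entry_amplify]
  have : (⟨entry ((S.matrix n).adj E).1 i j, ((S.matrix n).adj E).2 i j⟩ : S) =
      S.adj ⟨entry E.1 j i, E.2 j i⟩ := Subtype.ext (entry_star E.1 i j)
  rw [this, hΦ]
  rfl

theorem IsSelfAdjointMap.isSelfAdjoint {Φ : S →ₗ[ℂ] S'} (hΦ : IsSelfAdjointMap Φ) {E : S}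
    (hE : IsSelfAdjoint (E : H →L[ℂ] H)) : IsSelfAdjoint (Φ E : K →L[ℂ] K) := by
  have h : S.adj E = E := Subtype.ext hE
  have h' := hΦ E
  rw [h] at h'
  exact (congrArg Subtype.val h').symm

theorem IsUnital.map_sub_smul {Φ : S →ₗ[ℂ] S'} (hΦ : IsUnital Φ) (E : S) (c : ℂ) :
    (Φ (E - c • S.unit) : K →L[ℂ] K) = (Φ E : K →L[ℂ] K) - c • 1 := by
  rw [map_sub, map_smul, hΦ]
  rfl

theorem opDiam_div_le_sdiam (Φ : S →ₗ[ℂ] S') {E : S}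
    (hE : IsSelfAdjoint (E : H →L[ℂ] H)) (hns : ∀ c : ℂ, (E : H →L[ℂ] H) ≠ c • 1) :
    opDiam (Φ E : K →L[ℂ] K) / opDiam (E : H →L[ℂ] H) ≤ sdiam Φ :=
  le_iSup_of_le E (le_iSup₂ (f := fun _ _ => opDiam (Φ E : K →L[ℂ] K) / _) hE hns)

theorem opDiam_le_of_sdiam_le_one {Φ : S →ₗ[ℂ] S'} (h : sdiam Φ ≤ 1) {E : S}
    (hE : IsSelfAdjoint (E : H →L[ℂ] H)) (hns : ∀ c : ℂ, (E : H →L[ℂ] H) ≠ c • 1) :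
    opDiam (Φ E : K →L[ℂ] K) ≤ opDiam (E : H →L[ℂ] H) := by
  have h1 : opDiam (Φ E : K →L[ℂ] K) / opDiam (E : H →L[ℂ] H) ≤ 1 :=
    (opDiam_div_le_sdiam Φ hE hns).trans h
  rwa [ENNReal.div_le_iff_le_mul (.inr ENNReal.one_ne_top) (.inr one_ne_zero), one_mul] at h1

/-- A self-adjoint map whose amplifications do not increase the numerical diameter of self-adjoint
elements is completely contractive. -/
theorem norm_amplify_le_of_cbsdiam_le_one {Φ : S →ₗ[ℂ] S'} (hsa : IsSelfAdjointMap Φ)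
    (h : cbsdiam Φ ≤ 1) (hn : 1 ≤ n) (E : S.matrix n) : ‖amplify Φ n E‖ ≤ ‖E‖ := by
  -- For `E = 0` the dilation is the scalar 0, which `sdiam` excludes.
  rcases eq_or_ne E 0 with rfl | hE
  · simp
  have hE' : (E : HilbertSum H n →L[ℂ] HilbertSum H n) ≠ 0 := fun h0 => hE (Subtype.ext h0)
  have hs : sdiam (amplify Φ (n + n)) ≤ 1 :=
    le_trans (le_iSup₂_of_le (n + n) (by omega) le_rfl) h
  have h1 := opDiam_le_of_sdiam_le_one hs
    (E := OperatorSystem.offDiag E ((S.matrix n).adj E))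
    (isSelfAdjoint_offDiag E.1) (offDiag_ne_smul_one hE' _)
  rw [amplify_offDiag, hsa.amplify n E] at h1
  have h2 := (two_mul_norm_le_opDiam_offDiag (amplify Φ n E).1).trans
    (h1.trans (opDiam_le_two_mul_norm _))
  rw [ENNReal.ofReal_le_ofReal_iff (by positivity)] at h2
  have h3 := norm_offDiag_le E.1
  change ‖(amplify Φ n E).1‖ ≤ ‖E.1‖
  change 2 * ‖(amplify Φ n E).1‖ ≤ 2 * ‖offDiag E.1 (star E.1)‖ at h2
  linarith

/-- A unital positive map is contractive on self-adjoint elements. -/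
theorem norm_map_le_of_isSelfAdjoint {Ψ : S →ₗ[ℂ] S'} (hu : IsUnital Ψ) (hp : IsPositiveMap Ψ)
    {E : S} (hE : IsSelfAdjoint (E : H →L[ℂ] H)) {r : ℝ} (hr : ‖(E : H →L[ℂ] H)‖ ≤ r) :
    ‖(Ψ E : K →L[ℂ] K)‖ ≤ r := by
  have hc : ∀ F : S, (Ψ ((r : ℂ) • S.unit + F) : K →L[ℂ] K) = (r : ℂ) • 1 + (Ψ F).1 := fun F => by
    rw [map_add, map_smul, hu]
    rfl
  refine norm_le_of_isPositive ((norm_nonneg _).trans hr) ?_ ?_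
  · rw [← hc]
    exact hp _ (isPositive_of_norm_le hE hr)
  · have h := hp ((r : ℂ) • S.unit + -E) (isPositive_of_norm_le hE.neg (by rwa [norm_neg]))
    rw [hc, map_neg] at h
    rw [sub_eq_add_neg]
    exact h

/-- A unital completely positive map is completely contractive. -/
theorem IsCompletelyPositive.norm_amplify_le {Ψ : S →ₗ[ℂ] S'} (hu : IsUnital Ψ)
    (hp : IsCompletelyPositive Ψ) (hn : 1 ≤ n) (E : S.matrix n) : ‖amplify Ψ n E‖ ≤ ‖E‖ := by
  have h := norm_map_le_of_isSelfAdjoint (hu.amplify (n + n)) (hp (n + n) (by omega))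
    (E := OperatorSystem.offDiag E ((S.matrix n).adj E)) (isSelfAdjoint_offDiag E.1)
    (norm_offDiag_le E.1)
  rw [amplify_offDiag] at h
  exact (norm_le_norm_offDiag _ _).trans h

theorem amplify_amplify_of_leftInverse {Φ : S →ₗ[ℂ] S'} {Ψ : S' →ₗ[ℂ] S}
    (h : ∀ E, Ψ (Φ E) = E) (E : S.matrix n) : amplify Ψ n (amplify Φ n E) = E := by
  apply Subtype.ext
  apply hilbertSum_ext
  intro i j
  rw [entry_amplify]
  have : (⟨entry (amplify Φ n E).1 i j, (amplify Φ n E).2 i j⟩ : S') =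
      Φ ⟨entry E.1 i j, E.2 i j⟩ := Subtype.ext (entry_amplify Φ E i j)
  rw [this, h]

/-- A unital self-adjoint isometric map preserves numerical diameters of self-adjoint elements. -/
theorem opDiam_map_eq {Φ : S →ₗ[ℂ] S'} (hu : IsUnital Φ) (hsa : IsSelfAdjointMap Φ)
    (hiso : ∀ E, ‖Φ E‖ = ‖E‖) {E : S} (hE : IsSelfAdjoint (E : H →L[ℂ] H)) :
    opDiam (Φ E : K →L[ℂ] K) = opDiam (E : H →L[ℂ] H) := by
  have hnorm : ∀ c : ℂ, ‖(Φ E : K →L[ℂ] K) - c • 1‖ = ‖(E : H →L[ℂ] H) - c • 1‖ := fun c => by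
    rw [← hu.map_sub_smul]
    exact hiso (E - c • S.unit)
  -- Writes a finite diameter as `2r`, with `r` the radius that the distance lemmas use.
  have hform : ∀ x : ℝ≥0∞, x ≠ ∞ → x = ENNReal.ofReal (2 * (x.toReal / 2)) := fun x hx => by
    rw [mul_div_cancel₀ _ two_ne_zero, ENNReal.ofReal_toReal hx]
  apply le_antisymm
  · have h := hform _ (opDiam_ne_top (E : H →L[ℂ] H))
    obtain ⟨c, hc⟩ := exists_norm_sub_le_of_opDiam_le hE (by positivity) h.le
    rw [h]
    exact opDiam_le_of_norm_sub_le ((hnorm c).trans_le hc)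
  · have h := hform _ (opDiam_ne_top (Φ E : K →L[ℂ] K))
    obtain ⟨c, hc⟩ := exists_norm_sub_le_of_opDiam_le (hsa.isSelfAdjoint hE) (by positivity) h.le
    rw [h]
    exact opDiam_le_of_norm_sub_le ((hnorm c).symm.trans_le hc)

theorem opDiam_map_div_eq_one {Φ : S →ₗ[ℂ] S'} (hu : IsUnital Φ) (hsa : IsSelfAdjointMap Φ)
    (hiso : ∀ E, ‖Φ E‖ = ‖E‖) {E : S} (hE : IsSelfAdjoint (E : H →L[ℂ] H))
    (hns : ∀ c : ℂ, (E : H →L[ℂ] H) ≠ c • 1) :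
    opDiam (Φ E : K →L[ℂ] K) / opDiam (E : H →L[ℂ] H) = 1 := by
  rw [opDiam_map_eq hu hsa hiso hE, ENNReal.div_self (opDiam_ne_zero hE hns) (opDiam_ne_top _)]

theorem cbsdiam_eq_one_of_isCompletelyIsometric [Nontrivial H] {Φ : S →ₗ[ℂ] S'}
    (hu : IsUnital Φ) (hsa : IsSelfAdjointMap Φ) (h : IsCompletelyIsometric Φ) :
    cbsdiam Φ = 1 := by
  have hnorm : ∀ n, 1 ≤ n → ∀ E, ‖amplify Φ n E‖ = ‖E‖ := fun n hn =>
    (AddMonoidHomClass.isometry_iff_norm (amplify Φ n)).1 (h n hn)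
  apply le_antisymm
  · refine iSup₂_le fun n hn => iSup_le fun E => iSup₂_le fun hE hns => ?_
    exact (opDiam_map_div_eq_one (hu.amplify n) (hsa.amplify n) (hnorm n hn) hE hns).le
  -- The value 1 must be attained even if `S` is only the scalars. The dilation of the unit is a
  -- nonscalar self-adjoint element at size 2; it is nonzero because `H` is.
  · have hone : (1 : HilbertSum H 1 →L[ℂ] HilbertSum H 1) ≠ 0 := by
      obtain ⟨x, hx⟩ := exists_ne (0 : H)
      intro h0
      have := congrArg (fun f => f (coordIncl H 1 0 x) 0) h0
      simp at this
      exact hx this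
    have hE := isSelfAdjoint_offDiag (S.matrix 1).unit.1
    have hns := offDiag_ne_smul_one (A := (S.matrix 1).unit.1) hone (star (S.matrix 1).unit.1)
    refine le_iSup₂_of_le (1 + 1) (by norm_num) ?_
    rw [← opDiam_map_div_eq_one (hu.amplify (1 + 1)) (hsa.amplify (1 + 1))
      (hnorm (1 + 1) (by norm_num))
      (E := OperatorSystem.offDiag (S.matrix 1).unit ((S.matrix 1).adj (S.matrix 1).unit)) hE hns]
    exact opDiam_div_le_sdiam (amplify Φ (1 + 1)) hE hns

end maps

end

end NumDiam

open NumDiam in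
theorem mainTheorem3
    {H : Type*} [NormedAddCommGroup H] [InnerProductSpace ℂ H] [CompleteSpace H] [Nontrivial H]
    {K : Type*} [NormedAddCommGroup K] [InnerProductSpace ℂ K] [CompleteSpace K]
    (S : OperatorSystem H) (S' : OperatorSystem K)
    (Φ : S →L[ℂ] S')
    (hunital : IsUnital (Φ : S →ₗ[ℂ] S'))
    (hselfadj : IsSelfAdjointMap (Φ : S →ₗ[ℂ] S'))
    (hsection : ∃ Ψ : S' →ₗ[ℂ] S, IsUnital Ψ ∧ IsCompletelyPositive Ψ ∧ ∀ E : S, Ψ (Φ E) = E) :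
    cbsdiam (Φ : S →ₗ[ℂ] S') = 1 ↔ IsCompletelyIsometric (Φ : S →ₗ[ℂ] S') := by
  constructor
  · intro h n hn
    obtain ⟨Ψ, hΨu, hΨp, hΨ⟩ := hsection
    refine AddMonoidHomClass.isometry_of_norm _ fun E => le_antisymm ?_ ?_
    · exact norm_amplify_le_of_cbsdiam_le_one hselfadj h.le hn E
    -- `Ψ ⊗ idₙ` is a contraction that undoes `Φ ⊗ idₙ`.
    · have hle := hΨp.norm_amplify_le hΨu hn (amplify (Φ : S →ₗ[ℂ] S') n E)
      rwa [amplify_amplify_of_leftInverse hΨ E] at hle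
  · exact cbsdiam_eq_one_of_isCompletelyIsometric hunital hselfadj
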